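/- Let $(R,\mathfrak m)$ be a Noetherian local ring (with no assumption on the residue field $R/\mathfrak m$), let $I$ be an ideal of $R$ and let $M$ be a finitely generated $R$-module. Write $(N:L)=\{a\in R: aL\subseteq N\}$ for submodules $N,L$ of a module, and $(N:_MJ)=\{m\in M: Jm\subseteq N\}$ for a submodule $N\subseteq M$ and an ideal $J$. For an ideal $J$ of $R$ set $$r(J,M)=\bigcup_{k\ge 1}(J^{k+1}M:J^kM),\qquad \widetilde{JM}=\bigcup_{k\ge 1}(J^{k+1}M:_MJ^k),\qquad \widetilde{J}=\bigcup_{k\ge 1}(J^{k+1}:J^k),$$ and put $$\rho^I(M)=\min\{\,n\ge 0:\ \widetilde{I^iM}=I^iM\ \text{ for all } i\ge n\,\},$$ where $\widetilde{I^iM}$ is $\widetilde{JM}$ for $J=I^i$. Let $\operatorname{grade}(I,M)$ be the supremum of the lengths of $M$-regular sequences contained in $I$ (with $\operatorname{grade}(I,M)=\infty$ if $IM=M$). Suppose that $\operatorname{grade}(I,M)>0$. Then $\rho^I(M)$ is well defined (the minimum is taken over a nonempty set), and for all $k\ge\rho^I(M)$: (a) $r(I^n,M)=(I^{n+k}M:I^kM)$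 for all $n\ge 1$; (b) $\widetilde{I^nM}=(I^{n+k}M:_MI^k)$ for all $n\ge 1$. In particular, for $M=R$: if $\operatorname{grade}(I,R)>0$, then $\rho^I(R)$ is well defined and $\widetilde{I^n}=(I^{n+k}:I^k)$ for all $k\ge\rho^I(R)$ and every $n\ge 0$. -/

import Mathlib

namespace RatliffRush

variable {R : Type*} [CommRing R]

/-- The submodule `(N :_M J) = {m ∈ M | J m ⊆ N}` of `M`, for a submodule `N` of `M` and an
ideal `J` of `R`. -/
def moduleColon {M : Type*} [AddCommGroup M] [Module R M] (N : Submodule R M) (J : Ideal R) :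
    Submodule R M where
  carrier := {m | ∀ a ∈ J, a • m ∈ N}
  add_mem' hx hy a ha := by
    rw [smul_add]
    exact N.add_mem (hx a ha) (hy a ha)
  zero_mem' a _ := by simp
  smul_mem' c m hm a ha := by
    rw [smul_comm]
    exact N.smul_mem c (hm a ha)

section

variable (I : Ideal R) (M : Type*) [AddCommGroup M] [Module R M]

/-- `grade (I, M)`: the supremum of the lengths of the `M`-regular sequences contained in `I`,
with the usual convention that the grade is infinite when `I M = M`. -/
noncomputable def grade : ℕ∞ :=
  open Classical in
  if I • (⊤ : Submodule R M) = ⊤ then ⊤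
  else ⨆ rs : {rs : List R // (∀ x ∈ rs, x ∈ I) ∧ RingTheory.Sequence.IsRegular M rs},
    (rs.1.length : ℕ∞)

/-- The submodule `I ^ n M` of `M`. -/
def powSMul (n : ℕ) : Submodule R M := I ^ n • (⊤ : Submodule R M)

theorem smul_mem_powSMul_succ {a : R} (ha : a ∈ I) {n : ℕ} {m : M} (hm : m ∈ powSMul I M n) :
    a • m ∈ powSMul I M (n + 1) := by
  unfold powSMul at *
  rw [pow_succ', Submodule.mul_smul]
  exact Submodule.smul_mem_smul ha hm

/-- The ideals `(I ^ (k+1) M : I ^ k M)` form an ascending chain. -/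
theorem colon_chain_mono : Monotone fun k : ℕ =>
    (powSMul I M (k + 1)).colon (powSMul I M k : Set M) := by
  refine monotone_nat_of_le_succ fun k r hr => ?_
  rw [Submodule.mem_colon] at hr ⊢
  intro m hm
  have hm' : m ∈ I • powSMul I M k := by
    have h : m ∈ I ^ (k + 1) • (⊤ : Submodule R M) := hm
    rwa [pow_succ', Submodule.mul_smul] at h
  refine Submodule.smul_induction_on hm' (fun a ha x hx => ?_) fun x y hx hy => ?_
  · rw [smul_comm]
    exact smul_mem_powSMul_succ I M ha (hr x hx)
  · rw [smul_add]
    exact Submodule.add_mem _ hx hy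

/-- The submodules `(I ^ (k+1) M :_M I ^ k)` form an ascending chain. -/
theorem moduleColon_chain_mono : Monotone fun k : ℕ =>
    moduleColon (powSMul I M (k + 1)) (I ^ k) := by
  refine monotone_nat_of_le_succ fun k m hm => ?_
  intro a ha
  rw [pow_succ'] at ha
  refine Submodule.mul_induction_on ha (fun b hb c hc => ?_) fun x y hx hy => ?_
  · rw [mul_smul]
    exact smul_mem_powSMul_succ I M hb (hm c hc)
  · rw [add_smul]
    exact Submodule.add_mem _ hx hy

/-- The Ratliff-Rush ideal `r(I, M) = ⋃_{k ≥ 1} (I ^ (k+1) M : I ^ k M)`. -/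
def ratliffRushIdeal : Ideal R where
  carrier := {a | ∃ k ≥ 1, a ∈ (powSMul I M (k + 1)).colon (powSMul I M k : Set M)}
  add_mem' := by
    rintro a b ⟨k, hk, ha⟩ ⟨l, hl, hb⟩
    exact ⟨max k l, le_max_of_le_left hk, Ideal.add_mem _
      (colon_chain_mono I M (le_max_left k l) ha) (colon_chain_mono I M (le_max_right k l) hb)⟩
  zero_mem' := ⟨1, le_rfl, Ideal.zero_mem _⟩
  smul_mem' := by
    rintro c a ⟨k, hk, ha⟩
    exact ⟨k, hk, Ideal.mul_mem_left _ c ha⟩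

/-- The Ratliff-Rush submodule `⋃_{k ≥ 1} (I ^ (k+1) M :_M I ^ k)` of `M` associated with `I`. -/
def ratliffRushSubmodule : Submodule R M where
  carrier := {m | ∃ k ≥ 1, m ∈ moduleColon (powSMul I M (k + 1)) (I ^ k)}
  add_mem' := by
    rintro x y ⟨k, hk, hx⟩ ⟨l, hl, hy⟩
    exact ⟨max k l, le_max_of_le_left hk, Submodule.add_mem _
      (moduleColon_chain_mono I M (le_max_left k l) hx)
      (moduleColon_chain_mono I M (le_max_right k l) hy)⟩
  zero_mem' := ⟨1, le_rfl, Submodule.zero_mem _⟩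
  smul_mem' := by
    rintro c m ⟨k, hk, hm⟩
    exact ⟨k, hk, Submodule.smul_mem _ c hm⟩

/-- The set of all `n` such that the Ratliff-Rush submodule associated with `I ^ i` equals
`I ^ i M` for every `i ≥ n`. -/
def stableIndices : Set ℕ :=
  {n | ∀ i ≥ n, ratliffRushSubmodule (I ^ i) M = powSMul I M i}

/-- `ρ^I(M)`, the minimum of `stableIndices I M` (meaningful when that set is nonempty). -/
noncomputable def rho : ℕ := sInf (stableIndices I M)

end

/-- The ideals `(I ^ (k+1) : I ^ k)` form an ascending chain. -/
theorem ideal_colon_chain_mono (I : Ideal R) : Monotone fun k : ℕ =>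
    (I ^ (k + 1)).colon ((I ^ k : Ideal R) : Set R) := by
  have h := colon_chain_mono I R
  simpa only [powSMul, smul_eq_mul, Ideal.mul_top] using h

/-- The usual Ratliff-Rush closure `⋃_{k ≥ 1} (I ^ (k+1) : I ^ k)` of an ideal `I`. -/
def ratliffRushClosure (I : Ideal R) : Ideal R where
  carrier := {a | ∃ k ≥ 1, a ∈ (I ^ (k + 1)).colon ((I ^ k : Ideal R) : Set R)}
  add_mem' := by
    rintro a b ⟨k, hk, ha⟩ ⟨l, hl, hb⟩
    exact ⟨max k l, le_max_of_le_left hk, Ideal.add_mem _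
      (ideal_colon_chain_mono I (le_max_left k l) ha)
      (ideal_colon_chain_mono I (le_max_right k l) hb)⟩
  zero_mem' := ⟨1, le_rfl, Ideal.zero_mem _⟩
  smul_mem' := by
    rintro c a ⟨k, hk, ha⟩
    exact ⟨k, hk, Ideal.mul_mem_left _ c ha⟩

end RatliffRush

namespace RatliffRush

section

variable {R : Type*} [CommRing R] (I : Ideal R) (M : Type*) [AddCommGroup M] [Module R M]

/-! Once `I ^ (n+k) M` is Ratliff-Rush closed, both formulas follow by moving exponents. If `I ^ l m
⊆ I ^ (n+l) M` and `a ∈ I ^ k`, then `I ^ l (a m) ⊆ I ^ (n+k+l) M`, so `a m` lies in the closure of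
`I ^ (n+k) M`, which is `I ^ (n+k) M` itself (`ratliffRushSubmodule_eq_moduleColon`,
`ratliffRushIdeal_eq_colon`). Closedness for large exponents comes from an `M`-regular element of
`I`: Artin-Rees gives `(I ^ (j+1) M :_M I) ⊆ I ^ j M` for large `j` (`exists_moduleColon_le`), and
iterating this replaces `I` by any power of `I` (`moduleColon_pow_le`). If `I M = M`, all powers
give `M`. -/

theorem powSMul_pow (n l : ℕ) : powSMul (I ^ n) M l = powSMul I M (n * l) := by
  simp only [powSMul, pow_mul]

theorem smul_mem_powSMul_add {a : R} {k n : ℕ} (ha : a ∈ I ^ k) {m : M}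
    (hm : m ∈ powSMul I M n) : a • m ∈ powSMul I M (k + n) := by
  unfold powSMul at *
  rw [pow_add, Submodule.mul_smul]
  exact Submodule.smul_mem_smul ha hm

/-- The submodules `(I ^ (n+k) M :_M I ^ k)` increase with `k`. -/
theorem moduleColon_add_mono (n : ℕ) : Monotone fun k : ℕ =>
    moduleColon (powSMul I M (n + k)) (I ^ k) := by
  refine monotone_nat_of_le_succ fun k m hm a ha => ?_
  rw [pow_succ'] at ha
  refine Submodule.mul_induction_on ha (fun b hb c hc => ?_) fun x y hx hy => ?_
  · rw [mul_smul]
    exact smul_mem_powSMul_succ I M hb (hm c hc)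
  · rw [add_smul]
    exact Submodule.add_mem _ hx hy

/-- The ideals `(I ^ (n+k) M : I ^ k M)` increase with `k`. -/
theorem colon_add_mono (n : ℕ) : Monotone fun k : ℕ =>
    (powSMul I M (n + k)).colon (powSMul I M k : Set M) := by
  refine monotone_nat_of_le_succ fun k r hr => ?_
  rw [Submodule.mem_colon] at hr ⊢
  intro m hm
  have hm' : m ∈ I • powSMul I M k := by
    have h : m ∈ I ^ (k + 1) • (⊤ : Submodule R M) := hm
    rwa [pow_succ', Submodule.mul_smul] at h
  refine Submodule.smul_induction_on hm' (fun a ha x hx => ?_) fun x y hx hy => ?_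
  · rw [smul_comm]
    exact smul_mem_powSMul_succ I M ha (hr x hx)
  · rw [smul_add]
    exact Submodule.add_mem _ hx hy

/-- For `n ≥ 1` the Ratliff-Rush submodule of `I ^ n` is the union of all `(I ^ (n+k) M :_M I ^ k)`,
not only of those with `k` a multiple of `n`. -/
theorem mem_ratliffRushSubmodule_pow {n : ℕ} (hn : 1 ≤ n) {m : M} :
    m ∈ ratliffRushSubmodule (I ^ n) M ↔
      ∃ k, m ∈ moduleColon (powSMul I M (n + k)) (I ^ k) := by
  constructor
  · rintro ⟨l, -, hl⟩
    refine ⟨n * l, ?_⟩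
    rwa [powSMul_pow, ← pow_mul, Nat.mul_succ, add_comm] at hl
  · rintro ⟨k, hk⟩
    -- The index must be positive, hence `k + 1`; the exponent `n * (k + 1)` is at least `k`, so
    -- monotonicity applies.
    refine ⟨k + 1, Nat.le_add_left 1 k, ?_⟩
    rw [powSMul_pow, ← pow_mul, Nat.mul_succ n (k + 1), add_comm]
    exact moduleColon_add_mono I M n (by nlinarith : k ≤ n * (k + 1)) hk

/-- For `n ≥ 1` the Ratliff-Rush ideal of `I ^ n` is the union of all `(I ^ (n+k) M : I ^ k M)`,
not only of those with `k` a multiple of `n`. -/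
theorem mem_ratliffRushIdeal_pow {n : ℕ} (hn : 1 ≤ n) {a : R} :
    a ∈ ratliffRushIdeal (I ^ n) M ↔
      ∃ k, a ∈ (powSMul I M (n + k)).colon (powSMul I M k : Set M) := by
  constructor
  · rintro ⟨l, -, hl⟩
    refine ⟨n * l, ?_⟩
    rwa [powSMul_pow, powSMul_pow, Nat.mul_succ, add_comm] at hl
  · rintro ⟨k, hk⟩
    refine ⟨k + 1, Nat.le_add_left 1 k, ?_⟩
    rw [powSMul_pow, powSMul_pow, Nat.mul_succ n (k + 1), add_comm]
    exact colon_add_mono I M n (by nlinarith : k ≤ n * (k + 1)) hk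

theorem powSMul_le_ratliffRushSubmodule (i : ℕ) :
    powSMul I M i ≤ ratliffRushSubmodule (I ^ i) M := by
  intro m hm
  refine ⟨1, le_rfl, fun a ha => ?_⟩
  rw [powSMul_pow, Nat.mul_succ]
  rw [← pow_mul] at ha
  exact smul_mem_powSMul_add I M ha hm

/-! ### Colon formulas at a closed power -/

variable {I M}

theorem ratliffRushSubmodule_eq_moduleColon {n k : ℕ} (hn : 1 ≤ n)
    (h : ratliffRushSubmodule (I ^ (n + k)) M = powSMul I M (n + k)) :
    ratliffRushSubmodule (I ^ n) M = moduleColon (powSMul I M (n + k)) (I ^ k) := by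
  ext m
  rw [mem_ratliffRushSubmodule_pow I M hn]
  refine ⟨fun ⟨l, hl⟩ a ha => ?_, fun hm => ⟨k, hm⟩⟩
  rw [← h, mem_ratliffRushSubmodule_pow I M (by omega)]
  refine ⟨l, fun b hb => ?_⟩
  rw [smul_comm, add_right_comm, add_comm]
  exact smul_mem_powSMul_add I M ha (hl b hb)

/-- Closedness of the submodule also settles the ideal: for `x ∈ I ^ k M`, the element `a x` lies in
the closure of `I ^ (n+k) M`. -/
theorem ratliffRushIdeal_eq_colon {n k : ℕ} (hn : 1 ≤ n)
    (h : ratliffRushSubmodule (I ^ (n + k)) M = powSMul I M (n + k)) :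
    ratliffRushIdeal (I ^ n) M =
      (powSMul I M (n + k)).colon (powSMul I M k : Set M) := by
  ext a
  rw [mem_ratliffRushIdeal_pow I M hn]
  refine ⟨fun ⟨l, hl⟩ => ?_, fun ha => ⟨k, ha⟩⟩
  rw [Submodule.mem_colon]
  intro x hx
  rw [← h, mem_ratliffRushSubmodule_pow I M (by omega)]
  refine ⟨k + l, fun b hb => ?_⟩
  have hbx := smul_mem_powSMul_add I M hb hx
  rw [smul_comm]
  -- Since `b • x ∈ I ^ (k+l+k) M`, the colon condition on `a` is raised from `l` to that exponent.
  have key := colon_add_mono I M n (by omega : l ≤ k + l + k) hl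
  rw [Submodule.mem_colon] at key
  convert key _ hbx using 2
  omega

/-! ### Closedness of large powers -/

/-- An element of a finite power of `M` whose coordinates lie in `J M` lies in `J` times it. -/
theorem mem_smul_top_pi {ι : Type*} [Finite ι] (J : Ideal R) {y : ι → M}
    (hy : ∀ s, y s ∈ J • (⊤ : Submodule R M)) : y ∈ J • (⊤ : Submodule R (ι → M)) := by
  classical
  cases nonempty_fintype ι
  rw [← Finset.univ_sum_single y]
  refine Submodule.sum_mem _ fun s _ => ?_
  have h := Submodule.mem_map_of_mem (f := LinearMap.single R (fun _ : ι => M) s) (hy s)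
  rw [Submodule.map_smul''] at h
  exact Submodule.smul_mono le_rfl le_top h

theorem apply_mem_smul_top {N : Type*} [AddCommGroup N] [Module R N] (f : M →ₗ[R] N)
    (J : Ideal R) {y : M} (hy : y ∈ J • (⊤ : Submodule R M)) :
    f y ∈ J • (⊤ : Submodule R N) := by
  have h := Submodule.mem_map_of_mem (f := f) hy
  rw [Submodule.map_smul''] at h
  exact Submodule.smul_mono le_rfl le_top h

/-- If `I` kills no nonzero element of `M`, then `(I ^ (j+1) M :_M I) ⊆ I ^ j M` for large `j`:
apply the Artin-Rees lemma to the embedding of `M` into a finite power of itself given by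
multiplication with generators of `I`. -/
theorem exists_moduleColon_le [IsNoetherianRing R] [Module.Finite R M]
    (hI : ∀ m : M, (∀ a ∈ I, a • m = 0) → m = 0) :
    ∃ c : ℕ, ∀ j ≥ c, moduleColon (powSMul I M (j + 1)) I ≤ powSMul I M j := by
  obtain ⟨S, hS⟩ := IsNoetherian.noetherian I
  have hSI : ∀ s : S, (s : R) ∈ I := fun s => hS ▸ Submodule.subset_span s.2
  let φ : M →ₗ[R] (S → M) := LinearMap.pi fun s => LinearMap.lsmul R M (s : R)
  have hgen : ∀ (N : Submodule R M) (m : M), (∀ s, φ m s ∈ N) → ∀ a ∈ I, a • m ∈ N := by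
    intro N m h a ha
    rw [← hS] at ha
    refine Submodule.span_induction (fun x hx => h ⟨x, hx⟩) (by simp)
      (fun x y _ _ hx hy => ?_) (fun b x _ hx => ?_) ha
    · rw [add_smul]
      exact N.add_mem hx hy
    · rw [smul_assoc]
      exact N.smul_mem b hx
  have hinj : Function.Injective φ := by
    rw [← LinearMap.ker_eq_bot, LinearMap.ker_eq_bot']
    refine fun m hm => hI m fun a ha => ?_
    simpa using hgen ⊥ m (fun s => by simp [hm]) a ha
  obtain ⟨d, hd⟩ := I.exists_pow_inf_eq_pow_smul (LinearMap.range φ)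
  refine ⟨d, fun j hj m hm => ?_⟩
  have h1 : φ m ∈ I ^ (j + 1) • (⊤ : Submodule R (S → M)) ⊓ LinearMap.range φ :=
    ⟨mem_smul_top_pi _ fun s => hm _ (hSI s), m, rfl⟩
  rw [hd _ (by omega)] at h1
  -- If `φ x` has all coordinates in `I ^ d M`, then the generators of `I`, hence all of `I`, send
  -- `x` into `I ^ d M`.
  have h2 : I ^ d • (⊤ : Submodule R (S → M)) ⊓ LinearMap.range φ ≤
      (moduleColon (powSMul I M d) I).map φ := by
    rintro _ ⟨hy, x, rfl⟩
    exact ⟨x, hgen _ x fun s => apply_mem_smul_top (LinearMap.proj s) _ hy, rfl⟩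
  have h3 := Submodule.smul_mono (le_refl (I ^ (j + 1 - d))) h2 h1
  rw [← Submodule.map_smul''] at h3
  obtain ⟨x, hx, hxm⟩ := h3
  rw [← hinj hxm]
  have h4 : I • moduleColon (powSMul I M d) I ≤ powSMul I M d :=
    Submodule.smul_le.2 fun a ha y hy => hy a ha
  -- One factor `I` is spent on carrying `(I ^ d M :_M I)` into `I ^ d M`; the remaining `I ^ (j-d)`
  -- yields `I ^ j M`.
  rw [show j + 1 - d = (j - d) + 1 by omega, pow_succ, Submodule.mul_smul] at hx
  have h5 := Submodule.smul_mono (le_refl (I ^ (j - d))) h4 hx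
  rwa [powSMul, ← Submodule.mul_smul, ← pow_add, Nat.sub_add_cancel hj] at h5

/-- Induction on `N` with `i` free: for `b ∈ I`, the case `(N, i+1)` puts `b m` in `I ^ (i+1) M`,
and then `hc` puts `m` in `I ^ i M`. -/
theorem moduleColon_pow_le {c : ℕ}
    (hc : ∀ j ≥ c, moduleColon (powSMul I M (j + 1)) I ≤ powSMul I M j) (N : ℕ) :
    ∀ i ≥ c, moduleColon (powSMul I M (i + N)) (I ^ N) ≤ powSMul I M i := by
  induction N with
  | zero =>
    intro i _ m hm
    simpa using hm 1 (by simp)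
  | succ N ih =>
    intro i hi m hm
    refine hc i hi fun b hb => ih (i + 1) (by omega) fun a ha => ?_
    rw [smul_smul, show i + 1 + N = i + (N + 1) by omega]
    exact hm _ (by rw [pow_succ]; exact Ideal.mul_mem_mul ha hb)

/-- If `I` kills no nonzero element of `M`, then `I ^ i M` is Ratliff-Rush closed for large `i`. -/
theorem stableIndices_nonempty_of_faithful [IsNoetherianRing R] [Module.Finite R M]
    (hI : ∀ m : M, (∀ a ∈ I, a • m = 0) → m = 0) : (stableIndices I M).Nonempty := by
  obtain ⟨c, hc⟩ := exists_moduleColon_le hI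
  -- `c + 1` rather than `c` ensures `i ≥ 1`, needed to describe the closure by all exponents `k`.
  refine ⟨c + 1, fun i hi => le_antisymm (fun m hm => ?_) (powSMul_le_ratliffRushSubmodule I M i)⟩
  obtain ⟨k, hk⟩ := (mem_ratliffRushSubmodule_pow I M (by omega)).1 hm
  exact moduleColon_pow_le hc k i (by omega) hk

/-- Handles the case where the grade is infinite by convention and provides no regular element. -/
theorem stableIndices_nonempty_of_smul_top_eq (h : I • (⊤ : Submodule R M) = ⊤) :
    (stableIndices I M).Nonempty := by
  have htop : ∀ i, powSMul I M i = ⊤ := by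
    intro i
    induction i with
    | zero => simp [powSMul]
    | succ i ih => rw [powSMul, pow_succ, Submodule.mul_smul, h]; exact ih
  refine ⟨0, fun i _ => le_antisymm ?_ (powSMul_le_ratliffRushSubmodule I M i)⟩
  rw [htop]
  exact le_top

theorem exists_isSMulRegular_of_grade_pos (h : I • (⊤ : Submodule R M) ≠ ⊤)
    (hg : 0 < grade I M) : ∃ x ∈ I, IsSMulRegular M x := by
  rw [grade, if_neg h, lt_iSup_iff] at hg
  obtain ⟨⟨rs, hrs, hreg⟩, hlen⟩ := hg
  cases rs with
  | nil => simp at hlen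
  | cons x rs =>
    exact ⟨x, hrs x (by simp),
      ((RingTheory.Sequence.isWeaklyRegular_cons_iff M x rs).1 hreg.toIsWeaklyRegular).1⟩

theorem stableIndices_nonempty [IsNoetherianRing R] [Module.Finite R M]
    (hg : 0 < grade I M) : (stableIndices I M).Nonempty := by
  by_cases h : I • (⊤ : Submodule R M) = ⊤
  · exact stableIndices_nonempty_of_smul_top_eq h
  · obtain ⟨x, hx, hreg⟩ := exists_isSMulRegular_of_grade_pos h hg
    exact stableIndices_nonempty_of_faithful fun m hm => hreg (by simpa using hm x hx)

theorem ratliffRushSubmodule_eq_of_rho_le (h : (stableIndices I M).Nonempty) {i : ℕ}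
    (hi : rho I M ≤ i) : ratliffRushSubmodule (I ^ i) M = powSMul I M i :=
  Nat.sInf_mem h i hi

variable (I)

theorem powSMul_self (n : ℕ) : powSMul I R n = I ^ n := by
  simp [powSMul]

theorem ratliffRushIdeal_self : ratliffRushIdeal I R = ratliffRushClosure I := by
  ext a
  change (∃ k ≥ 1, a ∈ (powSMul I R (k + 1)).colon (powSMul I R k : Set R)) ↔
    ∃ k ≥ 1, a ∈ (I ^ (k + 1)).colon ((I ^ k : Ideal R) : Set R)
  simp only [powSMul_self]

theorem ratliffRushClosure_one : ratliffRushClosure (1 : Ideal R) = ⊤ :=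
  eq_top_iff.2 fun a _ => ⟨1, le_rfl, by rw [one_pow, Ideal.one_eq_top]; simp⟩

theorem colon_self (J : Ideal R) : J.colon (J : Set R) = ⊤ :=
  eq_top_iff.2 fun a _ => Submodule.mem_colon.2 fun _ hx => J.smul_mem a hx

end

end RatliffRush

theorem theorem8p10 {R : Type*} [CommRing R] [IsNoetherianRing R] [IsLocalRing R]
    (I : Ideal R) (M : Type*) [AddCommGroup M] [Module R M] [Module.Finite R M] :
    (0 < RatliffRush.grade I M →
      (RatliffRush.stableIndices I M).Nonempty ∧
      ∀ k ≥ RatliffRush.rho I M,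
        (∀ n ≥ 1, RatliffRush.ratliffRushIdeal (I ^ n) M =
          (RatliffRush.powSMul I M (n + k)).colon (RatliffRush.powSMul I M k : Set M)) ∧
        (∀ n ≥ 1, RatliffRush.ratliffRushSubmodule (I ^ n) M =
          RatliffRush.moduleColon (RatliffRush.powSMul I M (n + k)) (I ^ k))) ∧
    (0 < RatliffRush.grade I R →
      (RatliffRush.stableIndices I R).Nonempty ∧
      ∀ k ≥ RatliffRush.rho I R, ∀ n : ℕ,
        RatliffRush.ratliffRushClosure (I ^ n) =
          (I ^ (n + k)).colon ((I ^ k : Ideal R) : Set R)) := by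
  refine ⟨fun hg => ?_, fun hg => ?_⟩
  · have hne := RatliffRush.stableIndices_nonempty hg
    refine ⟨hne, fun k hk => ⟨fun n hn => ?_, fun n hn => ?_⟩⟩
    · exact RatliffRush.ratliffRushIdeal_eq_colon hn
        (RatliffRush.ratliffRushSubmodule_eq_of_rho_le hne (by omega))
    · exact RatliffRush.ratliffRushSubmodule_eq_moduleColon hn
        (RatliffRush.ratliffRushSubmodule_eq_of_rho_le hne (by omega))
  · have hne := RatliffRush.stableIndices_nonempty hg
    refine ⟨hne, fun k hk n => ?_⟩
    rcases Nat.eq_zero_or_pos n with rfl | hn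
    -- For `n = 0` both sides are the unit ideal.
    · rw [pow_zero, RatliffRush.ratliffRushClosure_one, zero_add, RatliffRush.colon_self]
    · rw [← RatliffRush.ratliffRushIdeal_self, RatliffRush.ratliffRushIdeal_eq_colon (k := k) hn
        (RatliffRush.ratliffRushSubmodule_eq_of_rho_le hne (by omega)),
        RatliffRush.powSMul_self, RatliffRush.powSMul_self]
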